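/- Consider classical randomized two-party protocols with private coins: Al holds $x\in\{0,1\}^n$, Bob holds $y\in\{0,1\}^n$, they exchange finitely many messages (bit strings) in rounds, each message depending on the sender's input, his private coins (independent of the inputs and of the other player's coins) and the messages exchanged so far, and at the end both know the result, which is determined by the exchanged messages. A protocol computes $f:\{0,1\}^n\times\{0,1\}^n\to\{0,1\}$ with error $\epsilon$ if for all $x,y$ the result is $f(x,y)$ with probability at least $1-\epsilon$. If the inputs $(X,Y)$ are drawn from a distribution $\mu$ and $A_t$, $B_t$ denote the private storage of Al and Bob after $t$ rounds (own coins and all messages exchanged so far), then the information divulged at time $t$ is $I(A_t:Y\mid X,f(X,Y))$ to Al and $I(B_t:X\mid Y,f(X,Y))$ to Bob, where $I$ is Shannon conditional mutual information in bits. The privacy loss of the protocol is the supremum of these quantities over all times $t$, both players and all distributions $\mu$ on $\{0,1\}^n\times\{0,1\}^n$, and $CL_\epsilon(f)$ is the infimum of the privacy loss over all such protocols computing $f$ with error $\epsilon$. Let $DISJ_n(x,y)=1$ if there is no $i$ with $x_i=y_i=1$, and $DISJ_n(x,y)=0$ otherwise. Then $$CL_{1/3}(DISJ_n)=\Omega\left(\frac{\sqrt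 n}{\log n}\right),$$ i.e. there are constants $c>0$ and $N$ such that for all $n\ge N$ every classical randomized protocol for $DISJ_n$ with error $1/3$ has privacy loss at least $c\sqrt n/\log_2 n$. -/

import Mathlib

namespace ApproxPrivacy

/-! ### Information theory for random variables on a finite probability space

A distribution on a finite type `Ω` is an element `p` of `stdSimplex ℝ Ω`; a random variable is a
function on `Ω`. Entropies are in bits. -/

section Information

variable {Ω S T W : Type*} [Fintype Ω]

open Classical in
/-- The probability of the event `E` under the weights `p`. -/
noncomputable def prob (p : Ω → ℝ) (E : Ω → Prop) : ℝ :=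
  ∑ ω, if E ω then p ω else 0

open Classical in
/-- The Shannon entropy `H(U) = -∑ₛ P(U = s) log₂ P(U = s)`; the sum is over the values that `U`
takes on the sample space. -/
noncomputable def entropy (p : Ω → ℝ) (U : Ω → S) : ℝ :=
  -∑ s ∈ Finset.univ.image U,
    prob p (fun ω => U ω = s) * Real.logb 2 (prob p (fun ω => U ω = s))

/-- The conditional mutual information `I(U : V | C) = H(UC) + H(VC) - H(C) - H(UVC)`. -/
noncomputable def condMutualInfo (p : Ω → ℝ) (U : Ω → S) (V : Ω → T) (C : Ω → W) : ℝ :=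
  entropy p (fun ω => (U ω, C ω)) + entropy p (fun ω => (V ω, C ω))
    - entropy p C - entropy p (fun ω => (U ω, V ω, C ω))

end Information

/-! ### Classical randomized two-party protocols -/

/-- The two players. -/
inductive Player where
  | al
  | bob

/-- A message is a string of bits. -/
abbrev Message : Type := List Bool

/-- The sequence of the messages exchanged so far, in chronological order. -/
abbrev History : Type := List Message

/-- A classical randomized (private coin) protocol with inputs `x : X` for Al and `y : Y` for Bob
and result in `Z`. Each player has private coins, independent of everything else. In every round
the messages exchanged so far determine whose turn it is, and that player sends a message that
depends on his own input, his own coins and the messages exchanged so far. The result is known to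
both players at the end, i.e. it is determined by the exchanged messages. -/
structure Protocol (X Y Z : Type) where
  CoinA : Type
  CoinB : Type
  [fintypeCoinA : Fintype CoinA]
  [fintypeCoinB : Fintype CoinB]
  coinDistA : stdSimplex ℝ CoinA
  coinDistB : stdSimplex ℝ CoinB
  rounds : ℕ
  turn : History → Player
  sendA : X → CoinA → History → Message
  sendB : Y → CoinB → History → Message
  result : History → Z

namespace Protocol

attribute [instance] Protocol.fintypeCoinA Protocol.fintypeCoinB

variable {X Y Z : Type} (P : Protocol X Y Z)

/-- The messages exchanged in the first `t` rounds on inputs `x`, `y` and coins `a`, `b`. -/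
def history (x : X) (y : Y) (a : P.CoinA) (b : P.CoinB) : ℕ → History
  | 0 => []
  | t + 1 =>
    let h := history x y a b t
    match P.turn h with
    | Player.al => h ++ [P.sendA x a h]
    | Player.bob => h ++ [P.sendB y b h]

/-- The result of the run on inputs `x`, `y` and coins `a`, `b`. -/
def run (x : X) (y : Y) (a : P.CoinA) (b : P.CoinB) : Z :=
  P.result (P.history x y a b P.rounds)

/-- The joint distribution of the two players' coins. -/
def coinWeight (c : P.CoinA × P.CoinB) : ℝ :=
  P.coinDistA.1 c.1 * P.coinDistB.1 c.2

/-- On every input, the probability of the result `f x y` is at least `1 - ε`. -/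
def Computes (f : X → Y → Z) (ε : ℝ) : Prop :=
  ∀ x y, 1 - ε ≤ prob P.coinWeight (fun c => P.run x y c.1 c.2 = f x y)

/-- The joint distribution of the inputs, drawn from `μ`, and of the coins. -/
def weight (μ : X × Y → ℝ) (ω : (X × Y) × (P.CoinA × P.CoinB)) : ℝ :=
  μ ω.1 * P.coinWeight ω.2

/-- Al's private storage after `t` rounds: an honest player may keep his coins and all messages. -/
def storageA (t : ℕ) (ω : (X × Y) × (P.CoinA × P.CoinB)) : P.CoinA × History :=
  (ω.2.1, P.history ω.1.1 ω.1.2 ω.2.1 ω.2.2 t)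

/-- Bob's private storage after `t` rounds. -/
def storageB (t : ℕ) (ω : (X × Y) × (P.CoinA × P.CoinB)) : P.CoinB × History :=
  (ω.2.2, P.history ω.1.1 ω.1.2 ω.2.1 ω.2.2 t)

variable [Fintype X] [Fintype Y]

/-- The information divulged to a player at time `t` if the inputs are drawn from `μ`:
`I(A : Y | X, f(X,Y))` for Al and `I(B : X | Y, f(X,Y))` for Bob. -/
noncomputable def divulged (f : X → Y → Z) (t : ℕ) (μ : X × Y → ℝ) : Player → ℝ
  | Player.al =>
    condMutualInfo (P.weight μ) (P.storageA t) (fun ω => ω.1.2)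
      (fun ω => (ω.1.1, f ω.1.1 ω.1.2))
  | Player.bob =>
    condMutualInfo (P.weight μ) (P.storageB t) (fun ω => ω.1.1)
      (fun ω => (ω.1.2, f ω.1.1 ω.1.2))

/-- The privacy loss of a protocol with respect to `f`: the supremum of the divulged information
over all times, both players and all distributions on the inputs. -/
noncomputable def privacyLoss (f : X → Y → Z) : EReal :=
  ⨆ (t : ℕ) (_ : t ≤ P.rounds) (i : Player) (μ : stdSimplex ℝ (X × Y)),
    (P.divulged f t μ.1 i : EReal)

end Protocol

/-- The classical privacy loss `CL_ε(f)`: the infimum of the privacy loss over all classical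
randomized protocols that compute `f` with error `ε`. -/
noncomputable def classicalPrivacyLoss {X Y Z : Type} [Fintype X] [Fintype Y]
    (ε : ℝ) (f : X → Y → Z) : EReal :=
  ⨅ (P : Protocol X Y Z) (_ : P.Computes f ε), P.privacyLoss f

/-- `DISJ_n`: the value is `true` iff the subsets of `{1, …, n}` with characteristic vectors `x`
and `y` are disjoint. -/
def disj (n : ℕ) (x y : Fin n → Bool) : Bool :=
  decide (∀ i, ¬(x i = true ∧ y i = true))

end ApproxPrivacy

/-! The bound proved is in fact linear in `n`; the stated rate is a weakening of it. For a set `S`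
of coordinates let Al hold a uniform subset of `S` and Bob an independent uniform subset of the
complement. The inputs are then always disjoint, so conditioning on the function value costs
nothing, and each player's bits are independent of each other and of the other player's input. Hence
the information divulged to a player is at least the sum over `i` of the information in the
transcript about the other player's `i`-th bit (`sum_log_le_condMutualInfo`), and each summand
dominates a squared Hellinger distance (`hellinger_le_sum_log`).

Fix `i` and the rest of `S`. Averaged over the other bits, the transcript law for `i`-th bits `(u,
v)` is a product `A u * B v`, because runs with a given transcript form a rectangle
(`history_cut_paste`). With `i` outside `S`, Al's information controls the distance between the laws
for `(0,0)` and `(0,1)`; with `i` in `S`, Bob's controls that between `(0,0)` and `(1,0)`. If both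
are small, then `(0,1)` and `(1,0)` are close, and by the product form so are `(0,0)` and `(1,1)`,
contradicting correctness (`rectangle_hellinger_gap`). So every `i` contributes a constant
(`hellinger_add_ge`), and averaging over `S` gives a single distribution and player with loss at
least `n / 1152`. -/

namespace ApproxPrivacy

/-! ### Mutual information, Gibbs' inequality and Hellinger distance -/

section Information

variable {Ω S T W K : Type*} [Fintype Ω]

lemma prob_nonneg {p : Ω → ℝ} (hp : ∀ ω, 0 ≤ p ω) (E : Ω → Prop) : 0 ≤ prob p E := by
  unfold prob
  exact Finset.sum_nonneg fun ω _ => by split_ifs <;> simp [hp]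

lemma le_prob {p : Ω → ℝ} (hp : ∀ ω, 0 ≤ p ω) {E : Ω → Prop} {ω : Ω} (h : E ω) :
    p ω ≤ prob p E := by
  classical
  unfold prob
  have := Finset.single_le_sum (f := fun ω => if E ω then p ω else 0)
    (fun ω _ => by split_ifs <;> simp [hp]) (Finset.mem_univ ω)
  simpa [h] using this

open Classical in
lemma sum_mul_comp_eq (p : Ω → ℝ) (U : Ω → S) {A : Finset S} (hA : ∀ ω, U ω ∈ A) (F : S → ℝ) :
    ∑ ω, p ω * F (U ω) = ∑ s ∈ A, prob p (fun ω => U ω = s) * F s := by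
  simp only [prob, Finset.sum_mul]
  rw [Finset.sum_comm]
  refine Finset.sum_congr rfl fun ω _ => ?_
  simp [ite_mul, hA]

lemma sum_prob_eq (p : Ω → ℝ) (U : Ω → S) {A : Finset S} (hA : ∀ ω, U ω ∈ A) :
    ∑ s ∈ A, prob p (fun ω => U ω = s) = ∑ ω, p ω := by
  simpa using (sum_mul_comp_eq p U hA (fun _ => 1)).symm

lemma sum_prob_and_eq (p : Ω → ℝ) (E : Ω → Prop) (U : Ω → S) {A : Finset S}
    (hA : ∀ ω, U ω ∈ A) :
    ∑ s ∈ A, prob p (fun ω => U ω = s ∧ E ω) = prob p E := by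
  classical
  unfold prob
  rw [Finset.sum_comm]
  refine Finset.sum_congr rfl fun ω _ => ?_
  by_cases h : E ω <;> simp [h, hA]

/-- Only an inequality: values of probability zero drop out on the left, division by zero being
zero. -/
lemma sum_mul_div_prob_le (p : Ω → ℝ) (U : Ω → S) {A : Finset S}
    (hA : ∀ ω, U ω ∈ A) {F : S → ℝ} (hF : ∀ s, 0 ≤ F s) :
    ∑ ω, p ω * (F (U ω) / prob p (fun ω' => U ω' = U ω)) ≤ ∑ s ∈ A, F s := by
  rw [sum_mul_comp_eq p U hA (fun s => F s / prob p (fun ω' => U ω' = s))]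
  refine Finset.sum_le_sum fun s _ => ?_
  rcases eq_or_ne (prob p (fun ω => U ω = s)) 0 with h | h
  · simp [h, hF]
  · rw [mul_div_cancel₀ _ h]

lemma entropy_eq (p : Ω → ℝ) (U : Ω → S) :
    entropy p U = -∑ ω, p ω * Real.logb 2 (prob p (fun ω' => U ω' = U ω)) := by
  classical
  unfold entropy
  rw [sum_mul_comp_eq p U (A := Finset.univ.image U) (by simp)
    (fun s => Real.logb 2 (prob p (fun ω' => U ω' = s)))]

lemma condMutualInfo_eq (p : Ω → ℝ) (U : Ω → S) (V : Ω → T) (C : Ω → W) :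
    condMutualInfo p U V C = ∑ ω, p ω *
      (Real.logb 2 (prob p (fun ω' => C ω' = C ω))
        + Real.logb 2 (prob p (fun ω' => (U ω', V ω', C ω') = (U ω, V ω, C ω)))
        - Real.logb 2 (prob p (fun ω' => (U ω', C ω') = (U ω, C ω)))
        - Real.logb 2 (prob p (fun ω' => (V ω', C ω') = (V ω, C ω)))) := by
  simp only [condMutualInfo, entropy_eq, mul_sub, mul_add, Finset.sum_sub_distrib,
    Finset.sum_add_distrib]
  ring

lemma one_sub_le_neg_log {x : ℝ} (hx : 0 < x) : 1 - x ≤ -Real.log x := by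
  linarith [Real.log_le_sub_one_of_pos hx]

/-- Information about a bit with prior `m`, bounded below by a squared Hellinger distance. -/
lemma hellinger_le_sum_log {p : Ω → ℝ} (hp : ∀ ω, 0 ≤ p ω) (hp1 : ∑ ω, p ω = 1)
    (V : Ω → Bool) (G : Ω → K) {A : Finset K} (hA : ∀ ω, G ω ∈ A)
    {m : Bool → ℝ} (hm : ∀ v, 0 ≤ m v) (hm1 : ∑ v, m v = 1) (hpos : ∀ ω, 0 < p ω → 0 < m (V ω)) :
    ∑ v, ∑ k ∈ A, (√(prob p (fun ω => V ω = v ∧ G ω = k))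
        - √(m v * prob p (fun ω => G ω = k))) ^ 2 ≤
      ∑ ω, p ω * Real.log (prob p (fun ω' => V ω' = V ω ∧ G ω' = G ω) /
        prob p (fun ω' => G ω' = G ω) / m (V ω)) := by
  classical
  set J : Bool → K → ℝ := fun v k => prob p (fun ω => V ω = v ∧ G ω = k) with hJ
  set r : K → ℝ := fun k => prob p (fun ω => G ω = k) with hr
  have hJ0 : ∀ v k, 0 ≤ J v k := fun v k => prob_nonneg hp _
  have hr0 : ∀ k, 0 ≤ r k := fun k => prob_nonneg hp _
  have hJs : ∑ v, ∑ k ∈ A, J v k = 1 := by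
    rw [Finset.sum_comm]
    calc ∑ k ∈ A, ∑ v, J v k = ∑ k ∈ A, r k :=
          Finset.sum_congr rfl fun k _ => sum_prob_and_eq p (fun ω => G ω = k) V (by simp)
      _ = 1 := by rw [hr, sum_prob_eq p G hA, hp1]
  have hmr : ∑ v, ∑ k ∈ A, m v * r k = 1 := by
    simp_rw [← Finset.mul_sum]
    rw [hr, sum_prob_eq p G hA, hp1]
    simpa using hm1
  have key : ∑ ω, p ω * (√(m (V ω) * r (G ω) * J (V ω) (G ω)) / J (V ω) (G ω)) ≤
      ∑ v, ∑ k ∈ A, √(m v * r k * J v k) := by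
    have := sum_mul_div_prob_le p (fun ω => (V ω, G ω)) (A := Finset.univ ×ˢ A)
      (by simpa using hA) (F := fun q => √(m q.1 * r q.2 * J q.1 q.2)) (fun _ => Real.sqrt_nonneg _)
    rw [Finset.sum_product] at this
    simpa [Prod.ext_iff, hJ] using this
  have hexp : ∑ v, ∑ k ∈ A, (√(J v k) - √(m v * r k)) ^ 2 =
      2 - 2 * ∑ v, ∑ k ∈ A, √(m v * r k * J v k) := by
    have : ∀ v k, (√(J v k) - √(m v * r k)) ^ 2 =
        J v k + m v * r k - 2 * √(m v * r k * J v k) := by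
      intro v k
      rw [Real.sqrt_mul (mul_nonneg (hm v) (hr0 k)), sub_sq, Real.sq_sqrt (hJ0 v k),
        Real.sq_sqrt (mul_nonneg (hm v) (hr0 k))]
      ring
    simp_rw [this, Finset.sum_sub_distrib, Finset.sum_add_distrib, ← Finset.mul_sum]
    rw [hJs, Finset.sum_congr rfl fun v _ => Finset.mul_sum _ _ _, hmr]
    ring
  -- Apply `1 - x ≤ -log x` to the square root of the likelihood ratio and double; twice one minus
  -- the affinity is the squared Hellinger distance.
  have hpt : ∀ ω, p ω * (2 - 2 * (√(m (V ω) * r (G ω) * J (V ω) (G ω)) / J (V ω) (G ω))) ≤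
      p ω * Real.log (J (V ω) (G ω) / r (G ω) / m (V ω)) := by
    intro ω
    rcases (hp ω).eq_or_lt with h | h
    · simp [← h]
    have h1 : 0 < J (V ω) (G ω) := h.trans_le (le_prob hp ⟨rfl, rfl⟩)
    have h2 : 0 < r (G ω) := h.trans_le (le_prob hp rfl)
    have h3 := hpos ω h
    refine mul_le_mul_of_nonneg_left ?_ h.le
    have h4 : √(m (V ω) * r (G ω) * J (V ω) (G ω)) / J (V ω) (G ω) =
        √(m (V ω) * r (G ω) / J (V ω) (G ω)) := by
      rw [Real.sqrt_mul (by positivity), Real.sqrt_div (by positivity), mul_div_assoc,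
        Real.sqrt_div_self', mul_one_div]
    have h5 := one_sub_le_neg_log (x := √(m (V ω) * r (G ω) / J (V ω) (G ω))) (by positivity)
    rw [Real.log_sqrt (by positivity)] at h5
    have h6 : Real.log (J (V ω) (G ω) / r (G ω) / m (V ω)) =
        - Real.log (m (V ω) * r (G ω) / J (V ω) (G ω)) := by
      rw [← Real.log_inv]; congr 1; field_simp
    rw [h4, h6]
    linarith
  have hsum := Finset.sum_le_sum fun ω (_ : ω ∈ Finset.univ) => hpt ω
  simp_rw [mul_sub, mul_left_comm _ (2 : ℝ), Finset.sum_sub_distrib, ← Finset.mul_sum] at hsum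
  rw [← Finset.sum_mul, hp1] at hsum
  rw [hexp]
  linarith

/-- If `V` consists of bits that are independent of each other and of `C`, then the information
about `V` is at least the sum of the informations about its bits. -/
lemma sum_log_le_condMutualInfo {ι : Type*} [Fintype ι] {p : Ω → ℝ} (hp : ∀ ω, 0 ≤ p ω)
    (hp1 : ∑ ω, p ω = 1) (U : Ω → S) (V : Ω → ι → Bool) (C : Ω → W) (G : Ω → K)
    (g : S → W → K) (hg : ∀ ω, G ω = g (U ω) (C ω)) (m : ι → Bool → ℝ)
    (hpos : ∀ ω, 0 < p ω → ∀ i, 0 < m i (V ω i))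
    (hind : ∀ ω, 0 < p ω → prob p (fun ω' => (V ω', C ω') = (V ω, C ω)) =
      prob p (fun ω' => C ω' = C ω) * ∏ i, m i (V ω i)) :
    ∑ i, ∑ ω, p ω * Real.log (prob p (fun ω' => V ω' i = V ω i ∧ G ω' = G ω) /
        prob p (fun ω' => G ω' = G ω) / m i (V ω i)) ≤
      Real.log 2 * condMutualInfo p U V C := by
  classical
  set q : ι → K → Bool → ℝ := fun i k v =>
    prob p (fun ω => V ω i = v ∧ G ω = k) / prob p (fun ω => G ω = k) with hq
  have hq0 : ∀ i k v, 0 ≤ q i k v := fun i k v => div_nonneg (prob_nonneg hp _) (prob_nonneg hp _)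
  -- Not an equality: the sum is zero if `k` has probability zero.
  have hq1 : ∀ i k, ∑ v, q i k v ≤ 1 := by
    intro i k
    rw [← Finset.sum_div, sum_prob_and_eq p (fun ω => G ω = k) (fun ω => V ω i) (by simp)]
    exact div_self_le_one _
  let F : S × (ι → Bool) × W → ℝ := fun s =>
    prob p (fun ω => (U ω, C ω) = (s.1, s.2.2)) * ∏ i, q i (g s.1 s.2.2) (s.2.1 i)
  have hF : ∀ s, 0 ≤ F s := fun s =>
    mul_nonneg (prob_nonneg hp _) (Finset.prod_nonneg fun i _ => hq0 _ _ _)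
  -- `F` is a subprobability: the true law of `(U, C)`, with the bits of `V` drawn independently
  -- from their posteriors given `G`. Gibbs' inequality against the true law of `(U, V, C)` gives
  -- the claim.
  have key : ∑ ω, p ω * (F (U ω, V ω, C ω) /
      prob p (fun ω' => (U ω', V ω', C ω') = (U ω, V ω, C ω))) ≤ 1 := by
    set A := Finset.univ.image (fun ω => (U ω, C ω)) with hA
    set B := (A ×ˢ (Finset.univ : Finset (ι → Bool))).image (fun s => (s.1.1, s.2, s.1.2)) with hB
    refine (sum_mul_div_prob_le p (fun ω => (U ω, V ω, C ω)) (A := B) ?_ hF).trans ?_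
    · intro ω
      simp only [hB, Finset.mem_image]
      exact ⟨((U ω, C ω), V ω), Finset.mem_product.2
        ⟨Finset.mem_image_of_mem _ (Finset.mem_univ ω), Finset.mem_univ _⟩, rfl⟩
    rw [hB, Finset.sum_image (by
      rintro ⟨⟨a, b⟩, c⟩ _ ⟨⟨a', b'⟩, c'⟩ _ h
      simp only [Prod.mk.injEq] at h ⊢
      tauto), Finset.sum_product]
    calc ∑ s ∈ A, ∑ v : ι → Bool, F (s.1, v, s.2)
        ≤ ∑ s ∈ A, prob p (fun ω => (U ω, C ω) = s) := by
          refine Finset.sum_le_sum fun s _ => ?_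
          simp only [F, ← Finset.mul_sum]
          refine mul_le_of_le_one_right (prob_nonneg hp _) ?_
          rw [← Fintype.piFinset_univ, ← Finset.prod_univ_sum]
          exact Finset.prod_le_one (fun i _ => Finset.sum_nonneg fun v _ => hq0 _ _ _)
            fun i _ => hq1 i _
      _ = 1 := by rw [sum_prob_eq p _ fun ω => Finset.mem_image_of_mem _ (Finset.mem_univ ω), hp1]
  have hpt : ∀ ω, p ω * (∑ i, Real.log (q i (G ω) (V ω i) / m i (V ω i))) + p ω *
      (1 - F (U ω, V ω, C ω) / prob p (fun ω' => (U ω', V ω', C ω') = (U ω, V ω, C ω))) ≤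
      Real.log 2 * (p ω * (Real.logb 2 (prob p (fun ω' => C ω' = C ω))
        + Real.logb 2 (prob p (fun ω' => (U ω', V ω', C ω') = (U ω, V ω, C ω)))
        - Real.logb 2 (prob p (fun ω' => (U ω', C ω') = (U ω, C ω)))
        - Real.logb 2 (prob p (fun ω' => (V ω', C ω') = (V ω, C ω))))) := by
    intro ω
    rcases (hp ω).eq_or_lt with h | h
    · simp [← h]
    have h1 : 0 < prob p (fun ω' => C ω' = C ω) := h.trans_le (le_prob hp rfl)
    have h2 : 0 < prob p (fun ω' => (U ω', V ω', C ω') = (U ω, V ω, C ω)) :=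
      h.trans_le (le_prob hp rfl)
    have h3 : 0 < prob p (fun ω' => (U ω', C ω') = (U ω, C ω)) := h.trans_le (le_prob hp rfl)
    have h4 : ∀ i, 0 < q i (G ω) (V ω i) := fun i =>
      div_pos (h.trans_le (le_prob hp ⟨rfl, rfl⟩)) (h.trans_le (le_prob hp rfl))
    have h5 := hpos ω h
    have hl : Real.log 2 ≠ 0 := (Real.log_pos one_lt_two).ne'
    have hFv : F (U ω, V ω, C ω) =
        prob p (fun ω' => (U ω', C ω') = (U ω, C ω)) * ∏ i, q i (G ω) (V ω i) := by
      simp only [F, hg]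
    have hQ : 0 < ∏ i, q i (G ω) (V ω i) := Finset.prod_pos fun i _ => h4 i
    have hM : 0 < ∏ i, m i (V ω i) := Finset.prod_pos fun i _ => h5 i
    rw [← mul_add, mul_left_comm]
    refine mul_le_mul_of_nonneg_left ?_ h.le
    have h6 := one_sub_le_neg_log (x := F (U ω, V ω, C ω) /
      prob p (fun ω' => (U ω', V ω', C ω') = (U ω, V ω, C ω))) (by rw [hFv]; positivity)
    have h7 : ∑ i, Real.log (q i (G ω) (V ω i) / m i (V ω i)) =
        Real.log (∏ i, q i (G ω) (V ω i)) - Real.log (∏ i, m i (V ω i)) := by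
      rw [Real.log_prod (fun i _ => (h4 i).ne'), Real.log_prod (fun i _ => (h5 i).ne'),
        ← Finset.sum_sub_distrib]
      exact Finset.sum_congr rfl fun i _ => Real.log_div (h4 i).ne' (h5 i).ne'
    rw [Real.log_div (by rw [hFv]; positivity) h2.ne'] at h6
    have h8 : Real.log (F (U ω, V ω, C ω)) =
        Real.log (prob p (fun ω' => (U ω', C ω') = (U ω, C ω))) +
          Real.log (∏ i, q i (G ω) (V ω i)) := by
      rw [hFv, Real.log_mul h3.ne' hQ.ne']
    have h9 : Real.log (prob p (fun ω' => (V ω', C ω') = (V ω, C ω))) =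
        Real.log (prob p (fun ω' => C ω' = C ω)) + Real.log (∏ i, m i (V ω i)) := by
      rw [hind ω h, Real.log_mul h1.ne' hM.ne']
    simp only [mul_sub, mul_add, Real.logb, mul_div_cancel₀ _ hl, h7, h9]
    linarith
  rw [condMutualInfo_eq, Finset.sum_comm, Finset.mul_sum]
  simp_rw [← Finset.mul_sum]
  have hsum := Finset.sum_le_sum fun ω (_ : ω ∈ Finset.univ) => hpt ω
  rw [Finset.sum_add_distrib, ← Finset.mul_sum] at hsum
  have : 0 ≤ ∑ ω, p ω * (1 - F (U ω, V ω, C ω) /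
      prob p (fun ω' => (U ω', V ω', C ω') = (U ω, V ω, C ω))) := by
    simp_rw [mul_sub, mul_one, Finset.sum_sub_distrib, hp1]
    linarith
  linarith

lemma sum_hellinger_le_condMutualInfo {ι : Type*} [Fintype ι] {p : Ω → ℝ} (hp : ∀ ω, 0 ≤ p ω)
    (hp1 : ∑ ω, p ω = 1) (U : Ω → S) (V : Ω → ι → Bool) (C : Ω → W) (G : Ω → K)
    {A : Finset K} (hA : ∀ ω, G ω ∈ A)
    (g : S → W → K) (hg : ∀ ω, G ω = g (U ω) (C ω)) (m : ι → Bool → ℝ)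
    (hm : ∀ i v, 0 ≤ m i v) (hm1 : ∀ i, ∑ v, m i v = 1)
    (hpos : ∀ ω, 0 < p ω → ∀ i, 0 < m i (V ω i))
    (hind : ∀ ω, 0 < p ω → prob p (fun ω' => (V ω', C ω') = (V ω, C ω)) =
      prob p (fun ω' => C ω' = C ω) * ∏ i, m i (V ω i)) :
    ∑ i, ∑ v, ∑ k ∈ A, (√(prob p (fun ω => V ω i = v ∧ G ω = k))
        - √(m i v * prob p (fun ω => G ω = k))) ^ 2 ≤
      Real.log 2 * condMutualInfo p U V C :=
  (Finset.sum_le_sum fun i _ => hellinger_le_sum_log hp hp1 (fun ω => V ω i) G hA (hm i) (hm1 i)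
    fun ω h => hpos ω h i).trans
    (sum_log_le_condMutualInfo hp hp1 U V C G g hg m hpos hind)

end Information

/-! ### Rectangle structure of transcripts -/

namespace Protocol

variable {X Y Z : Type} (P : Protocol X Y Z)

lemma history_succ (x : X) (y : Y) (a : P.CoinA) (b : P.CoinB) (t : ℕ) :
    ∃ msg, P.history x y a b (t + 1) = P.history x y a b t ++ [msg] := by
  simp only [history]
  cases P.turn (P.history x y a b t) <;> exact ⟨_, rfl⟩

/-- The runs with a given history form a rectangle. -/
lemma history_cut_paste {x x' : X} {y y' : Y} {a a' : P.CoinA} {b b' : P.CoinB} {t : ℕ}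
    (h : P.history x y a b t = P.history x' y' a' b' t) :
    P.history x y' a b' t = P.history x y a b t := by
  induction t with
  | zero => rfl
  | succ t ih =>
    have h0 : P.history x y a b t = P.history x' y' a' b' t := by
      obtain ⟨m₁, h₁⟩ := P.history_succ x y a b t
      obtain ⟨m₂, h₂⟩ := P.history_succ x' y' a' b' t
      rw [h₁, h₂] at h
      -- Each round appends exactly one message, so equal histories have equal prefixes.
      exact (List.append_inj' h rfl).1
    have h1 := ih h0
    simp only [history] at h ⊢
    rw [h1]
    rw [← h0] at h
    cases ht : P.turn (P.history x y a b t) with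
    | al => rfl
    | bob =>
      simp only [ht] at h ⊢
      exact h.symm

/-- The probability that Al's coins are compatible with the transcript `h` on input `x`. -/
noncomputable def compatA (x : X) (h : History) : ℝ :=
  prob P.coinDistA.1 (fun a => ∃ y b, P.history x y a b P.rounds = h)

/-- The probability that Bob's coins are compatible with the transcript `h` on input `y`. -/
noncomputable def compatB (y : Y) (h : History) : ℝ :=
  prob P.coinDistB.1 (fun b => ∃ x a, P.history x y a b P.rounds = h)

lemma compatA_nonneg (x : X) (h : History) : 0 ≤ P.compatA x h := prob_nonneg P.coinDistA.2.1 _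

lemma compatB_nonneg (y : Y) (h : History) : 0 ≤ P.compatB y h := prob_nonneg P.coinDistB.2.1 _

lemma history_eq_iff (x : X) (y : Y) (a : P.CoinA) (b : P.CoinB) (h : History) :
    P.history x y a b P.rounds = h ↔
      (∃ y b, P.history x y a b P.rounds = h) ∧ ∃ x a, P.history x y a b P.rounds = h := by
  refine ⟨fun e => ⟨⟨y, b, e⟩, x, a, e⟩, ?_⟩
  rintro ⟨⟨y', b', e⟩, x', a', e'⟩
  rw [P.history_cut_paste (e.trans e'.symm), e]

/-- The coins are independent and the runs with transcript `h` form a rectangle. -/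
lemma prob_history_eq (x : X) (y : Y) (h : History) :
    prob P.coinWeight (fun c => P.history x y c.1 c.2 P.rounds = h) =
      P.compatA x h * P.compatB y h := by
  classical
  simp only [prob, compatA, compatB, P.history_eq_iff x y, Fintype.sum_prod_type,
    Finset.sum_mul_sum, coinWeight]
  refine Finset.sum_congr rfl fun a _ => Finset.sum_congr rfl fun b _ => ?_
  rw [ite_and]
  split_ifs <;> simp

lemma coinWeight_nonneg (c : P.CoinA × P.CoinB) : 0 ≤ P.coinWeight c :=
  mul_nonneg (P.coinDistA.2.1 _) (P.coinDistB.2.1 _)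

lemma sum_coinWeight : ∑ c, P.coinWeight c = 1 := by
  simp only [coinWeight, Fintype.sum_prod_type, ← Finset.mul_sum, P.coinDistB.2.2, mul_one,
    P.coinDistA.2.2]

lemma weight_nonneg {μ : X × Y → ℝ} (hμ : ∀ z, 0 ≤ μ z) (ω : (X × Y) × (P.CoinA × P.CoinB)) :
    0 ≤ P.weight μ ω := mul_nonneg (hμ _) (P.coinWeight_nonneg _)

variable [Fintype X] [Fintype Y]

open Classical in
/-- The transcripts of the complete runs. -/
noncomputable def transcripts : Finset History :=
  Finset.univ.image fun ω : (X × Y) × (P.CoinA × P.CoinB) =>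
    P.history ω.1.1 ω.1.2 ω.2.1 ω.2.2 P.rounds

lemma history_mem_transcripts (x : X) (y : Y) (a : P.CoinA) (b : P.CoinB) :
    P.history x y a b P.rounds ∈ P.transcripts := by
  classical
  exact Finset.mem_image_of_mem
    (fun ω : (X × Y) × (P.CoinA × P.CoinB) => P.history ω.1.1 ω.1.2 ω.2.1 ω.2.2 P.rounds)
    (Finset.mem_univ ((x, y), (a, b)))

lemma sum_transcripts (x : X) (y : Y) (φ : History → ℝ) :
    ∑ h ∈ P.transcripts, P.compatA x h * P.compatB y h * φ h =
      ∑ c, P.coinWeight c * φ (P.history x y c.1 c.2 P.rounds) := by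
  rw [sum_mul_comp_eq P.coinWeight (fun c => P.history x y c.1 c.2 P.rounds)
    (fun c => P.history_mem_transcripts x y c.1 c.2) φ]
  simp only [prob_history_eq]

lemma prob_weight_fst (μ : X × Y → ℝ) (E : X × Y → Prop) :
    prob (P.weight μ) (fun ω => E ω.1) = prob μ E := by
  classical
  simp only [prob, weight, Fintype.sum_prod_type (α₁ := X × Y)]
  refine Finset.sum_congr rfl fun z _ => ?_
  split_ifs
  · rw [← Finset.mul_sum, sum_coinWeight, mul_one]
  · simp

lemma sum_weight {μ : X × Y → ℝ} (hμ : ∑ z, μ z = 1) : ∑ ω, P.weight μ ω = 1 := by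
  simp only [weight, Fintype.sum_prod_type (α₁ := X × Y), ← Finset.mul_sum, sum_coinWeight,
    mul_one, hμ]

/-- The product form survives averaging over independent inputs and restricting each input
separately. -/
lemma prob_weight_history (a : X → ℝ) (b : Y → ℝ) (E : X → Prop) (F : Y → Prop)
    [DecidablePred E] [DecidablePred F] (h : History) :
    prob (P.weight fun z => a z.1 * b z.2)
      (fun ω => (E ω.1.1 ∧ F ω.1.2) ∧ P.history ω.1.1 ω.1.2 ω.2.1 ω.2.2 P.rounds = h) =
      (∑ x, if E x then a x * P.compatA x h else 0) *
        ∑ y, if F y then b y * P.compatB y h else 0 := by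
  rw [Finset.sum_mul_sum]
  simp only [prob, weight, Fintype.sum_prod_type (α₁ := X × Y), Fintype.sum_prod_type (α₁ := X)]
  refine Finset.sum_congr rfl fun x _ => Finset.sum_congr rfl fun y _ => ?_
  by_cases hE : E x
  · by_cases hF : F y
    · simp only [hE, hF, and_self, true_and, if_true]
      rw [mul_mul_mul_comm, ← P.prob_history_eq, prob, Finset.mul_sum]
      exact Finset.sum_congr rfl fun c _ => by split_ifs <;> simp
    · simp [hF]
  · simp [hE]

end Protocol

/-! ### Product distributions on which the function is constant -/

section Independence

variable {X Y Z : Type} [Fintype X] [Fintype Y]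

lemma prob_pair_fst_eq {a : X → ℝ} {b : Y → ℝ} (hb : ∑ y, b y = 1) {f : X → Y → Z} {c : Z}
    (hf : ∀ x y, a x * b y ≠ 0 → f x y = c) (x : X) :
    prob (fun z : X × Y => a z.1 * b z.2) (fun z => (z.1, f z.1 z.2) = (x, c)) = a x := by
  classical
  simp only [prob, Fintype.sum_prod_type]
  rw [Finset.sum_eq_single x (fun x' _ hx' => by simp [hx']) (by simp)]
  calc _ = ∑ y, a x * b y := Finset.sum_congr rfl fun y _ => by
        by_cases h : a x * b y = 0
        · simp [h]
        · simp [hf x y h]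
    _ = a x := by rw [← Finset.mul_sum, hb, mul_one]

lemma prob_pair_snd_eq {a : X → ℝ} {b : Y → ℝ} (ha : ∑ x, a x = 1) {f : X → Y → Z} {c : Z}
    (hf : ∀ x y, a x * b y ≠ 0 → f x y = c) (y : Y) :
    prob (fun z : X × Y => a z.1 * b z.2) (fun z => (z.2, f z.1 z.2) = (y, c)) = b y := by
  classical
  simp only [prob, Fintype.sum_prod_type_right]
  rw [Finset.sum_eq_single y (fun y' _ hy' => by simp [hy']) (by simp)]
  calc _ = ∑ x, a x * b y := Finset.sum_congr rfl fun x _ => by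
        by_cases h : a x * b y = 0
        · simp [h]
        · simp [hf x y h]
    _ = b y := by rw [← Finset.sum_mul, ha, one_mul]

lemma prob_eq_single (p : X → ℝ) (x : X) {E : X → Prop} (hE : ∀ x', E x' ↔ x' = x) :
    prob p E = p x := by
  classical
  simp [prob, hE]

end Independence

/-! ### Hellinger estimates for product-form transcript laws -/

section Hellinger

lemma half_sq_sub_le (u v t : ℝ) : (u - v) ^ 2 / 2 ≤ (u - t) ^ 2 + (v - t) ^ 2 := by
  nlinarith [sq_nonneg (u + v - 2 * t)]

lemma sqrt_mul_sub_sq {p q : ℝ} (hp : 0 ≤ p) (hq : 0 ≤ q) :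
    (√p - √q) ^ 2 = p + q - 2 * √(p * q) := by
  rw [sub_sq, Real.sq_sqrt hp, Real.sq_sqrt hq, Real.sqrt_mul hp]
  ring

/-- Factor `p - q` as `(√p - √q) * (√p + √q)` and use AM-GM. The weights are chosen so that for two
probability distributions the last term sums to `1 / 6`, half of the gap `2 / 3 - 1 / 3`. -/
lemma mul_sub_le_sqrt_sub_sq {p q φ : ℝ} (hp : 0 ≤ p) (hq : 0 ≤ q) (hφ0 : 0 ≤ φ) (hφ1 : φ ≤ 1) :
    p * φ - q * φ ≤ 6 * (√p - √q) ^ 2 + (p + q) / 12 := by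
  obtain ⟨s, hs, rfl⟩ : ∃ s, 0 ≤ s ∧ s ^ 2 = p := ⟨√p, Real.sqrt_nonneg _, Real.sq_sqrt hp⟩
  obtain ⟨t, ht, rfl⟩ : ∃ t, 0 ≤ t ∧ t ^ 2 = q := ⟨√q, Real.sqrt_nonneg _, Real.sq_sqrt hq⟩
  rw [Real.sqrt_sq hs, Real.sqrt_sq ht]
  have h : s ^ 2 - t ^ 2 ≤ 6 * (s - t) ^ 2 + (s ^ 2 + t ^ 2) / 12 := by
    nlinarith [sq_nonneg (12 * (s - t) - (s + t)), sq_nonneg (s - t)]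
  have h0 : 0 ≤ 6 * (s - t) ^ 2 + (s ^ 2 + t ^ 2) / 12 := by positivity
  rcases le_total (s ^ 2 - t ^ 2) 0 with h1 | h1
  · nlinarith
  · nlinarith

/-- Distributions `A u * B v` for `u, v ∈ {0, 1}` on the transcripts: if those for `(0, 0)` and
`(1, 1)` are distinguishable then those for `(0, 0)`, `(0, 1)` and `(1, 0)` are not all close. -/
lemma rectangle_hellinger_gap {K : Type*} (T : Finset K) (A B : Bool → K → ℝ)
    (hA : ∀ u k, 0 ≤ A u k) (hB : ∀ u k, 0 ≤ B u k)
    (h1 : ∀ u v, ∑ k ∈ T, A u k * B v k = 1) (φ : K → ℝ) (hφ0 : ∀ k, 0 ≤ φ k)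
    (hφ1 : ∀ k, φ k ≤ 1) (hlo : 2 / 3 ≤ ∑ k ∈ T, A false k * B false k * φ k)
    (hhi : ∑ k ∈ T, A true k * B true k * φ k ≤ 1 / 3) :
    1 / 72 ≤ ∑ k ∈ T, (√(A false k * B false k) - √(A false k * B true k)) ^ 2 +
      ∑ k ∈ T, (√(A false k * B false k) - √(A true k * B false k)) ^ 2 := by
  have hAB : ∀ u v k, 0 ≤ A u k * B v k := fun u v k => mul_nonneg (hA u k) (hB v k)
  have hdiag : 1 / 36 ≤ ∑ k ∈ T, (√(A false k * B false k) - √(A true k * B true k)) ^ 2 := by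
    have := Finset.sum_le_sum fun k (_ : k ∈ T) =>
      mul_sub_le_sqrt_sub_sq (hAB false false k) (hAB true true k) (hφ0 k) (hφ1 k)
    rw [Finset.sum_sub_distrib, Finset.sum_add_distrib, ← Finset.mul_sum, ← Finset.sum_div,
      Finset.sum_add_distrib, h1, h1] at this
    linarith
  -- Cut and paste: both pairs have the same product `A 0 * B 1 * A 1 * B 0`, hence the same
  -- affinity.
  have hswap : ∑ k ∈ T, (√(A false k * B true k) - √(A true k * B false k)) ^ 2 =
      ∑ k ∈ T, (√(A false k * B false k) - √(A true k * B true k)) ^ 2 := by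
    simp_rw [sqrt_mul_sub_sq (hAB _ _ _) (hAB _ _ _), Finset.sum_sub_distrib,
      Finset.sum_add_distrib, h1]
    congr 1
    refine Finset.sum_congr rfl fun k _ => ?_
    congr 2
    ring
  have htri := Finset.sum_le_sum fun k (_ : k ∈ T) => half_sq_sub_le (√(A false k * B true k))
    (√(A true k * B false k)) (√(A false k * B false k))
  rw [← Finset.sum_div, hswap, Finset.sum_add_distrib] at htri
  simp_rw [sub_sq_comm (√(A false _ * B false _))] at hdiag ⊢
  simp_rw [sub_sq_comm (√(A false _ * B false _))] at htri
  linarith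

end Hellinger

/-! ### Splitting off one coordinate of the cube -/

section Glue

variable {ι : Type*} [DecidableEq ι]

/-- The point of the cube with `i`-th bit `u` and other bits `x`. -/
def glue (i : ι) (u : Bool) (x : {j // j ≠ i} → Bool) : ι → Bool :=
  (Equiv.funSplitAt i Bool).symm (u, x)

lemma glue_self (i : ι) (u : Bool) (x : {j // j ≠ i} → Bool) : glue i u x i = u := by
  simp [glue, Equiv.funSplitAt]

lemma glue_ne (i : ι) (u : Bool) (x : {j // j ≠ i} → Bool) (j : {j // j ≠ i}) :
    glue i u x j = x j := by
  simp [glue, Equiv.funSplitAt, j.2]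

lemma not_glue (i : ι) (u : Bool) (x : {j // j ≠ i} → Bool) :
    (fun j => !glue i u x j) = glue i (!u) (fun j => !x j) := by
  funext j
  by_cases h : j = i
  · subst h; simp [glue_self]
  · rw [glue_ne i u x ⟨j, h⟩, glue_ne i _ _ ⟨j, h⟩]

end Glue

/-! ### Uniform distributions on subcubes -/

section Cube

variable {ι : Type*} [Fintype ι]

/-- The distribution of a bit that is uniform if `s` holds and `false` otherwise. -/
noncomputable def bitDist (s v : Bool) : ℝ := if s then 1 / 2 else if v then 0 else 1

lemma bitDist_nonneg (s v : Bool) : 0 ≤ bitDist s v := by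
  unfold bitDist; split_ifs <;> norm_num

lemma sum_bitDist (s : Bool) : ∑ v, bitDist s v = 1 := by
  cases s <;> simp [bitDist]

/-- The uniform distribution on the subsets of `S`. -/
noncomputable def cubeDist (S x : ι → Bool) : ℝ := ∏ i, bitDist (S i) (x i)

lemma cubeDist_nonneg (S x : ι → Bool) : 0 ≤ cubeDist S x :=
  Finset.prod_nonneg fun _ _ => bitDist_nonneg _ _

variable [DecidableEq ι]

lemma sum_cubeDist (S : ι → Bool) : ∑ x, cubeDist S x = 1 := by
  unfold cubeDist
  rw [← Fintype.piFinset_univ, ← Finset.prod_univ_sum]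
  exact Finset.prod_eq_one fun i _ => sum_bitDist _

lemma sum_cube_eq (i : ι) (F : (ι → Bool) → ℝ) : ∑ x, F x = ∑ u, ∑ x, F (glue i u x) := by
  rw [← Fintype.sum_prod_type', ← (Equiv.funSplitAt i Bool).symm.sum_comp]
  rfl

lemma cubeDist_glue (i : ι) (s u : Bool) (S x : {j // j ≠ i} → Bool) :
    cubeDist (glue i s S) (glue i u x) = bitDist s u * cubeDist S x := by
  unfold cubeDist
  rw [Fintype.prod_eq_mul_prod_subtype_ne _ i]
  simp only [glue_self, glue_ne]

/-- The expectation of `F` if bit `i` is `u` and the other bits have distribution `cubeDist S`. -/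
noncomputable def condMean (i : ι) (S : {j // j ≠ i} → Bool) (F : (ι → Bool) → ℝ) (u : Bool) : ℝ :=
  ∑ x, cubeDist S x * F (glue i u x)

lemma condMean_nonneg (i : ι) (S : {j // j ≠ i} → Bool) {F : (ι → Bool) → ℝ}
    (hF : ∀ x, 0 ≤ F x) (u : Bool) : 0 ≤ condMean i S F u :=
  Finset.sum_nonneg fun _ _ => mul_nonneg (cubeDist_nonneg _ _) (hF _)

lemma sum_ite_cubeDist_glue (i : ι) (s u : Bool) (S : {j // j ≠ i} → Bool) (F : (ι → Bool) → ℝ) :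
    (∑ x, if x i = u then cubeDist (glue i s S) x * F x else 0) =
      bitDist s u * condMean i S F u := by
  rw [sum_cube_eq i]
  simp only [glue_self, cubeDist_glue, condMean, Finset.mul_sum]
  rw [Finset.sum_eq_single u (fun v _ hv => by simp [hv]) (by simp)]
  simp [mul_assoc]

lemma sum_cubeDist_glue_false (i : ι) (S : {j // j ≠ i} → Bool) (F : (ι → Bool) → ℝ) :
    ∑ x, cubeDist (glue i false S) x * F x = condMean i S F false := by
  rw [sum_cube_eq i]
  simp [cubeDist_glue, condMean, bitDist]

end Cube

/-! ### The lower bound for disjointness -/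

section Disjointness

variable {n : ℕ}

lemma bitDist_mul_bitDist_not {s u v : Bool} (h : bitDist s u * bitDist (!s) v ≠ 0) :
    ¬(u = true ∧ v = true) := by
  rintro ⟨rfl, rfl⟩
  cases s <;> simp [bitDist] at h

lemma cubeDist_mul_disj {ι : Type*} [Fintype ι] {S x y : ι → Bool}
    (h : cubeDist S x * cubeDist (fun i => !S i) y ≠ 0) (i : ι) :
    ¬(x i = true ∧ y i = true) := by
  unfold cubeDist at h
  rw [← Finset.prod_mul_distrib, Finset.prod_ne_zero_iff] at h
  exact bitDist_mul_bitDist_not (h i (Finset.mem_univ i))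

lemma disj_of_cubeDist {S x y : Fin n → Bool}
    (h : cubeDist S x * cubeDist (fun i => !S i) y ≠ 0) : disj n x y = true := by
  simpa only [disj, decide_eq_true_eq] using cubeDist_mul_disj h

/-- Al's input is a uniform subset of `S` and Bob's an independent uniform subset of the
complement of `S`. -/
noncomputable def splitDist (S : Fin n → Bool) (z : (Fin n → Bool) × (Fin n → Bool)) : ℝ :=
  cubeDist S z.1 * cubeDist (fun i => !S i) z.2

lemma splitDist_mem (S : Fin n → Bool) : splitDist S ∈ stdSimplex ℝ _ := by
  refine ⟨fun z => mul_nonneg (cubeDist_nonneg _ _) (cubeDist_nonneg _ _), ?_⟩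
  simp only [splitDist, Fintype.sum_prod_type, ← Finset.mul_sum, sum_cubeDist, mul_one]

variable (P : Protocol (Fin n → Bool) (Fin n → Bool) Bool)

/-- The squared Hellinger distance of the joint distribution of Bob's `i`-th bit and the transcript
to the product of the marginal distributions. -/
noncomputable def hellingerA (S : Fin n → Bool) (i : Fin n) : ℝ :=
  ∑ v, ∑ h ∈ P.transcripts, (√(prob (P.weight (splitDist S)) (fun ω => ω.1.2 i = v ∧
      P.history ω.1.1 ω.1.2 ω.2.1 ω.2.2 P.rounds = h)) -
    √(bitDist (!S i) v * prob (P.weight (splitDist S)) (fun ω =>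
      P.history ω.1.1 ω.1.2 ω.2.1 ω.2.2 P.rounds = h))) ^ 2

/-- The squared Hellinger distance of the joint distribution of Al's `i`-th bit and the transcript
to the product of the marginal distributions. -/
noncomputable def hellingerB (S : Fin n → Bool) (i : Fin n) : ℝ :=
  ∑ v, ∑ h ∈ P.transcripts, (√(prob (P.weight (splitDist S)) (fun ω => ω.1.1 i = v ∧
      P.history ω.1.1 ω.1.2 ω.2.1 ω.2.2 P.rounds = h)) -
    √(bitDist (S i) v * prob (P.weight (splitDist S)) (fun ω =>
      P.history ω.1.1 ω.1.2 ω.2.1 ω.2.2 P.rounds = h))) ^ 2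

lemma hellingerA_nonneg (S : Fin n → Bool) (i : Fin n) : 0 ≤ hellingerA P S i :=
  Finset.sum_nonneg fun _ _ => Finset.sum_nonneg fun _ _ => sq_nonneg _

lemma hellingerB_nonneg (S : Fin n → Bool) (i : Fin n) : 0 ≤ hellingerB P S i :=
  Finset.sum_nonneg fun _ _ => Finset.sum_nonneg fun _ _ => sq_nonneg _

lemma bitDist_pos_of_cubeDist {ι : Type*} [Fintype ι] {S x : ι → Bool} (h : cubeDist S x ≠ 0)
    (i : ι) : 0 < bitDist (S i) (x i) :=
  (bitDist_nonneg _ _).lt_of_ne' (Finset.prod_ne_zero_iff.1 h i (Finset.mem_univ i))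

/-- The transcript is part of Al's storage, and given his input and the value, which is always
`true` here, Bob's bits are still independent with laws `bitDist (!S i)`. -/
lemma sum_hellingerA_le (S : Fin n → Bool) :
    ∑ i, hellingerA P S i ≤
      Real.log 2 * P.divulged (disj n) P.rounds (splitDist S) Player.al := by
  have hz : ∀ ω, 0 < P.weight (splitDist S) ω → cubeDist S ω.1.1 ≠ 0 ∧
      cubeDist (fun i => !S i) ω.1.2 ≠ 0 := fun ω h =>
    mul_ne_zero_iff.1 (left_ne_zero_of_mul h.ne')
  refine sum_hellinger_le_condMutualInfo (P.weight_nonneg (splitDist_mem S).1)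
    (P.sum_weight (splitDist_mem S).2) (P.storageA P.rounds) (fun ω => ω.1.2)
    (fun ω => (ω.1.1, disj n ω.1.1 ω.1.2))
    (fun ω => P.history ω.1.1 ω.1.2 ω.2.1 ω.2.2 P.rounds)
    (fun ω => P.history_mem_transcripts _ _ _ _) (fun s _ => s.2) (fun _ => rfl)
    (fun i => bitDist (!S i)) (fun _ _ => bitDist_nonneg _ _) (fun _ => sum_bitDist _)
    (fun ω h => bitDist_pos_of_cubeDist (hz ω h).2) fun ω h => ?_
  have hd : disj n ω.1.1 ω.1.2 = true := disj_of_cubeDist (mul_ne_zero (hz ω h).1 (hz ω h).2)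
  rw [P.prob_weight_fst (splitDist S) (fun z => (z.2, z.1, disj n z.1 z.2) = _),
    P.prob_weight_fst (splitDist S) (fun z => (z.1, disj n z.1 z.2) = _), hd,
    prob_eq_single _ ω.1]
  · unfold splitDist
    rw [prob_pair_fst_eq (a := cubeDist S) (f := disj n) (sum_cubeDist _) fun x y => disj_of_cubeDist]
    rfl
  · rintro ⟨x, y⟩
    constructor
    · intro e
      simp only [Prod.mk.injEq] at e
      exact Prod.ext e.2.1 e.1
    · intro e
      simp [← hd, ← e]

lemma sum_hellingerB_le (S : Fin n → Bool) :
    ∑ i, hellingerB P S i ≤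
      Real.log 2 * P.divulged (disj n) P.rounds (splitDist S) Player.bob := by
  have hz : ∀ ω, 0 < P.weight (splitDist S) ω → cubeDist S ω.1.1 ≠ 0 ∧
      cubeDist (fun i => !S i) ω.1.2 ≠ 0 := fun ω h =>
    mul_ne_zero_iff.1 (left_ne_zero_of_mul h.ne')
  refine sum_hellinger_le_condMutualInfo (P.weight_nonneg (splitDist_mem S).1)
    (P.sum_weight (splitDist_mem S).2) (P.storageB P.rounds) (fun ω => ω.1.1)
    (fun ω => (ω.1.2, disj n ω.1.1 ω.1.2))
    (fun ω => P.history ω.1.1 ω.1.2 ω.2.1 ω.2.2 P.rounds)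
    (fun ω => P.history_mem_transcripts _ _ _ _) (fun s _ => s.2) (fun _ => rfl)
    (fun i => bitDist (S i)) (fun _ _ => bitDist_nonneg _ _) (fun _ => sum_bitDist _)
    (fun ω h => bitDist_pos_of_cubeDist (hz ω h).1) fun ω h => ?_
  have hd : disj n ω.1.1 ω.1.2 = true := disj_of_cubeDist (mul_ne_zero (hz ω h).1 (hz ω h).2)
  rw [P.prob_weight_fst (splitDist S) (fun z => (z.1, z.2, disj n z.1 z.2) = _),
    P.prob_weight_fst (splitDist S) (fun z => (z.2, disj n z.1 z.2) = _), hd,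
    prob_eq_single _ ω.1]
  · unfold splitDist
    rw [prob_pair_snd_eq (f := disj n) (sum_cubeDist _) fun x y => disj_of_cubeDist, mul_comm]
    rfl
  · rintro ⟨x, y⟩
    constructor
    · intro e
      simp only [Prod.mk.injEq] at e
      exact Prod.ext e.1 e.2.1
    · intro e
      simp [← hd, ← e]

/-- The compatibility of Al's side with transcript `h`, if his `i`-th bit is `u` and the other bits
are random. -/
noncomputable def sideA (i : Fin n) (S : {j // j ≠ i} → Bool) (u : Bool) (h : History) : ℝ :=
  condMean i S (fun x => P.compatA x h) u

/-- The compatibility of Bob's side with transcript `h`, if his `i`-th bit is `v` and the other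
bits are random. -/
noncomputable def sideB (i : Fin n) (S : {j // j ≠ i} → Bool) (v : Bool) (h : History) : ℝ :=
  condMean i (fun j => !S j) (fun y => P.compatB y h) v

/-- For a uniform bit the joint law with the transcript carries a factor `1 / 2`, and `t` is the
root of half the marginal, the same for both bit values. -/
lemma quarter_sq_sub_le {p q t : ℝ} :
    (√p - √q) ^ 2 / 4 ≤ (√(p / 2) - t) ^ 2 + (√(q / 2) - t) ^ 2 := by
  refine le_trans (le_of_eq ?_) (half_sq_sub_le _ _ _)
  rw [Real.sqrt_div' _ zero_le_two, Real.sqrt_div' _ zero_le_two, ← sub_div, div_pow,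
    Real.sq_sqrt zero_le_two]
  ring

/-- Here `i` lies outside Al's set, so his `i`-th bit is `false` and Bob's is uniform. -/
lemma le_hellingerA (i : Fin n) (S : {j // j ≠ i} → Bool) :
    (∑ h ∈ P.transcripts, (√(sideA P i S false h * sideB P i S false h) -
      √(sideA P i S false h * sideB P i S true h)) ^ 2) / 4 ≤ hellingerA P (glue i false S) i := by
  have hJ : ∀ v h, prob (P.weight (splitDist (glue i false S))) (fun ω => ω.1.2 i = v ∧
      P.history ω.1.1 ω.1.2 ω.2.1 ω.2.2 P.rounds = h) =
      sideA P i S false h * sideB P i S v h / 2 := by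
    intro v h
    have := P.prob_weight_history (cubeDist (glue i false S))
      (cubeDist (fun j => !glue i false S j)) (fun _ => True) (fun y => y i = v) h
    simp only [true_and, if_true, sum_cubeDist_glue_false] at this
    rw [not_glue] at this
    refine Eq.trans ?_ (this.trans ?_)
    · unfold splitDist
      rw [not_glue]
    · rw [sum_ite_cubeDist_glue]
      simp only [bitDist, sideA, sideB]
      simp
      ring
  unfold hellingerA
  rw [Fintype.sum_bool, ← Finset.sum_add_distrib, Finset.sum_div]
  refine Finset.sum_le_sum fun h _ => ?_
  simp only [hJ, glue_self]
  rw [add_comm]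
  exact quarter_sq_sub_le

lemma le_hellingerB (i : Fin n) (S : {j // j ≠ i} → Bool) :
    (∑ h ∈ P.transcripts, (√(sideA P i S false h * sideB P i S false h) -
      √(sideA P i S true h * sideB P i S false h)) ^ 2) / 4 ≤ hellingerB P (glue i true S) i := by
  have hJ : ∀ v h, prob (P.weight (splitDist (glue i true S))) (fun ω => ω.1.1 i = v ∧
      P.history ω.1.1 ω.1.2 ω.2.1 ω.2.2 P.rounds = h) =
      sideA P i S v h * sideB P i S false h / 2 := by
    intro v h
    have := P.prob_weight_history (cubeDist (glue i true S))
      (cubeDist (fun j => !glue i true S j)) (fun x => x i = v) (fun _ => True) h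
    rw [not_glue] at this
    simp only [and_true, if_true, Bool.not_true, sum_cubeDist_glue_false] at this
    refine Eq.trans ?_ (this.trans ?_)
    · unfold splitDist
      rw [not_glue]
      rfl
    · rw [sum_ite_cubeDist_glue]
      simp only [bitDist, sideA, sideB]
      simp
      ring
  unfold hellingerB
  rw [Fintype.sum_bool, ← Finset.sum_add_distrib, Finset.sum_div]
  refine Finset.sum_le_sum fun h _ => ?_
  simp only [hJ, glue_self]
  rw [add_comm]
  exact quarter_sq_sub_le

/-- Identifies the product of the two sides as a mixture of genuine transcript laws, also for `u = v
= true`, a case outside the support of every `splitDist`. -/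
lemma sum_sideA_mul_sideB (i : Fin n) (S : {j // j ≠ i} → Bool) (u v : Bool) (φ : History → ℝ) :
    ∑ h ∈ P.transcripts, sideA P i S u h * sideB P i S v h * φ h =
      ∑ x, ∑ y, cubeDist S x * cubeDist (fun j => !S j) y *
        ∑ c, P.coinWeight c *
          φ (P.history (glue i u x) (glue i v y) c.1 c.2 P.rounds) := by
  simp only [← P.sum_transcripts, Finset.mul_sum, sideA, sideB, condMean, Finset.sum_mul]
  conv_rhs => rw [Finset.sum_comm]
  rw [Finset.sum_comm]
  refine Finset.sum_congr rfl fun x _ => ?_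
  rw [Finset.sum_comm]
  exact Finset.sum_congr rfl fun y _ => Finset.sum_congr rfl fun h _ => by ring

lemma sum_cubeDist_mul_cubeDist {ι : Type*} [Fintype ι] [DecidableEq ι] (S R : ι → Bool) (c : ℝ) :
    ∑ x, ∑ y, cubeDist S x * cubeDist R y * c = c := by
  simp only [← Finset.sum_mul, ← Finset.mul_sum, sum_cubeDist, mul_one, one_mul]

lemma sum_sideA_mul_sideB_one (i : Fin n) (S : {j // j ≠ i} → Bool) (u v : Bool) :
    ∑ h ∈ P.transcripts, sideA P i S u h * sideB P i S v h = 1 := by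
  have := sum_sideA_mul_sideB P i S u v (fun _ => 1)
  simpa only [mul_one, P.sum_coinWeight, ← Finset.mul_sum, sum_cubeDist] using this

/-- Whether the result is `true`. -/
noncomputable def resultTrue (h : History) : ℝ := if P.result h = true then 1 else 0

lemma sum_coinWeight_resultTrue (x y : Fin n → Bool) :
    ∑ c, P.coinWeight c * resultTrue P (P.history x y c.1 c.2 P.rounds) =
      prob P.coinWeight (fun c => P.run x y c.1 c.2 = true) := by
  unfold prob
  refine Finset.sum_congr rfl fun c _ => ?_
  by_cases h : P.result (P.history x y c.1 c.2 P.rounds) = true <;>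
    simp [resultTrue, Protocol.run, h]

lemma prob_run_true_le (hP : P.Computes (disj n) (1 / 3)) {x y : Fin n → Bool}
    (h : disj n x y = false) : prob P.coinWeight (fun c => P.run x y c.1 c.2 = true) ≤ 1 / 3 := by
  have h1 := hP x y
  rw [h] at h1
  have h2 := sum_prob_eq P.coinWeight (fun c => P.run x y c.1 c.2) (A := Finset.univ) (by simp)
  rw [P.sum_coinWeight, Fintype.sum_bool] at h2
  linarith

/-- The other coordinates never intersect, so the `i`-th bits alone decide disjointness and
correctness separates `(0,0)` from `(1,1)`. The constant is `1 / 72`, divided by the `4` lost in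
`le_hellingerA` and `le_hellingerB`. -/
lemma hellinger_add_ge (hP : P.Computes (disj n) (1 / 3)) (i : Fin n) (S : {j // j ≠ i} → Bool) :
    1 / 288 ≤ hellingerA P (glue i false S) i + hellingerB P (glue i true S) i := by
  have key := rectangle_hellinger_gap P.transcripts (sideA P i S) (sideB P i S)
    (fun u h => condMean_nonneg i S (fun x => P.compatA_nonneg x h) u)
    (fun u h => condMean_nonneg i _ (fun x => P.compatB_nonneg x h) u)
    (sum_sideA_mul_sideB_one P i S) (resultTrue P)
    (fun h => by unfold resultTrue; split_ifs <;> norm_num)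
    (fun h => by unfold resultTrue; split_ifs <;> norm_num)
    (by
      rw [sum_sideA_mul_sideB, ← sum_cubeDist_mul_cubeDist S (fun j => !S j) (2 / 3)]
      refine Finset.sum_le_sum fun x _ => Finset.sum_le_sum fun y _ => ?_
      by_cases h : cubeDist S x * cubeDist (fun j => !S j) y = 0
      · simp [h]
      refine mul_le_mul_of_nonneg_left ?_ (mul_nonneg (cubeDist_nonneg _ _) (cubeDist_nonneg _ _))
      have hd : disj n (glue i false x) (glue i false y) = true := by
        simp only [disj, decide_eq_true_eq]
        intro j
        by_cases hj : j = i
        · subst hj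
          simp [glue_self]
        · rw [glue_ne i false x ⟨j, hj⟩, glue_ne i false y ⟨j, hj⟩]
          exact cubeDist_mul_disj h ⟨j, hj⟩
      have := hP (glue i false x) (glue i false y)
      rw [hd] at this
      rw [sum_coinWeight_resultTrue]
      linarith)
    (by
      rw [sum_sideA_mul_sideB, ← sum_cubeDist_mul_cubeDist S (fun j => !S j) (1 / 3)]
      refine Finset.sum_le_sum fun x _ => Finset.sum_le_sum fun y _ => ?_
      refine mul_le_mul_of_nonneg_left ?_ (mul_nonneg (cubeDist_nonneg _ _) (cubeDist_nonneg _ _))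
      rw [sum_coinWeight_resultTrue]
      refine prob_run_true_le P hP ?_
      simp only [disj, decide_eq_false_iff_not]
      exact fun h => h i ⟨glue_self _ _ _, glue_self _ _ _⟩)
  have hA := le_hellingerA P i S
  have hB := le_hellingerB P i S
  linarith

lemma card_cube_eq (i : Fin n) :
    (Fintype.card (Fin n → Bool) : ℝ) = 2 * Fintype.card ({j // j ≠ i} → Bool) := by
  rw [Fintype.card_congr (Equiv.funSplitAt i Bool)]
  simp

lemma sum_divulged_ge (hP : P.Computes (disj n) (1 / 3)) :
    n * Fintype.card (Fin n → Bool) / 576 ≤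
      ∑ S, (P.divulged (disj n) P.rounds (splitDist S) Player.al +
        P.divulged (disj n) P.rounds (splitDist S) Player.bob) := by
  have h1 : ∀ i, (Fintype.card (Fin n → Bool) : ℝ) / 576 ≤
      ∑ S, (hellingerA P S i + hellingerB P S i) := by
    intro i
    -- Pair the two sets that differ only at `i`. Each pair contributes `1 / 288`, and there are
    -- half as many pairs as sets.
    rw [sum_cube_eq i, Fintype.sum_bool, ← Finset.sum_add_distrib, card_cube_eq i]
    calc (2 * Fintype.card ({j // j ≠ i} → Bool) : ℝ) / 576
        = ∑ _S : {j // j ≠ i} → Bool, (1 / 288 : ℝ) := by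
          simp only [Finset.sum_const, Finset.card_univ, nsmul_eq_mul]; ring
      _ ≤ _ := Finset.sum_le_sum fun S _ => by
          linarith [hellinger_add_ge P hP i S, hellingerA_nonneg P (glue i true S) i,
            hellingerB_nonneg P (glue i false S) i]
  have h2 : (n * Fintype.card (Fin n → Bool) / 576 : ℝ) ≤
      ∑ S, ∑ i, (hellingerA P S i + hellingerB P S i) := by
    rw [Finset.sum_comm]
    refine le_trans (le_of_eq ?_) (Finset.sum_le_sum fun i _ => h1 i)
    simp only [Finset.sum_const, Finset.card_univ, nsmul_eq_mul, Fintype.card_fin]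
    ring
  have h3 : ∑ S, ∑ i, (hellingerA P S i + hellingerB P S i) ≤
      Real.log 2 * ∑ S, (P.divulged (disj n) P.rounds (splitDist S) Player.al +
        P.divulged (disj n) P.rounds (splitDist S) Player.bob) := by
    rw [Finset.mul_sum]
    refine Finset.sum_le_sum fun S _ => ?_
    rw [Finset.sum_add_distrib, mul_add]
    exact add_le_add (sum_hellingerA_le P S) (sum_hellingerB_le P S)
  -- The factor `log 2` from measuring in bits is below one and can be dropped.
  have h4 := Real.log_two_lt_d9
  have h5 := Real.log_two_gt_d9
  have h6 : (0 : ℝ) ≤ n * Fintype.card (Fin n → Bool) / 576 := by positivity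
  nlinarith

lemma exists_divulged_ge (hP : P.Computes (disj n) (1 / 3)) :
    ∃ S i, (n : ℝ) / 1152 ≤ P.divulged (disj n) P.rounds (splitDist S) i := by
  -- The average over `S` of the two players' total is at least `n / 576`, so some player gets half
  -- of that for some `S`.
  by_contra! hcon
  have h := sum_divulged_ge P hP
  have h' : ∑ S, (P.divulged (disj n) P.rounds (splitDist S) Player.al +
      P.divulged (disj n) P.rounds (splitDist S) Player.bob) <
      ∑ _S : Fin n → Bool, ((n : ℝ) / 576) :=
    Finset.sum_lt_sum_of_nonempty Finset.univ_nonempty fun S _ => by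
      linarith [hcon S Player.al, hcon S Player.bob]
  simp only [Finset.sum_const, Finset.card_univ, nsmul_eq_mul] at h'
  have : (n * Fintype.card (Fin n → Bool) / 576 : ℝ) = Fintype.card (Fin n → Bool) * (n / 576) := by
    ring
  linarith

/-- The privacy loss of every protocol for disjointness is linear in the input length. -/
theorem le_classicalPrivacyLoss_disj (n : ℕ) :
    (((n : ℝ) / 1152 : ℝ) : EReal) ≤ classicalPrivacyLoss (1 / 3) (disj n) := by
  refine le_iInf₂ fun P hP => ?_
  obtain ⟨S, i, h⟩ := exists_divulged_ge P hP
  refine (EReal.coe_le_coe_iff.2 h).trans ?_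
  unfold Protocol.privacyLoss
  exact le_iSup₂_of_le P.rounds le_rfl (le_iSup₂_of_le i ⟨splitDist S, splitDist_mem S⟩ le_rfl)

end Disjointness

lemma sqrt_div_logb_le {n : ℕ} (hn : 2 ≤ n) : √n / Real.logb 2 n ≤ n := by
  have hn' : (2 : ℝ) ≤ n := by exact_mod_cast hn
  have h1 : 1 ≤ Real.logb 2 n := by
    rw [Real.le_logb_iff_rpow_le one_lt_two (by linarith), Real.rpow_one]
    exact hn'
  refine (div_le_self (Real.sqrt_nonneg _) h1).trans ?_
  rw [Real.sqrt_le_left (by linarith)]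
  nlinarith

end ApproxPrivacy

theorem mainTheorem2 :
    ∃ c : ℝ, 0 < c ∧ ∃ N : ℕ, ∀ n : ℕ, N ≤ n →
      ((c * (Real.sqrt n / Real.logb 2 n) : ℝ) : EReal) ≤
        ApproxPrivacy.classicalPrivacyLoss (1 / 3) (ApproxPrivacy.disj n) := by
  -- From `n = 2` on the logarithm is at least one, so the linear bound dominates.
  refine ⟨1 / 1152, by norm_num, 2, fun n hn => ?_⟩
  refine le_trans (EReal.coe_le_coe_iff.2 ?_) (ApproxPrivacy.le_classicalPrivacyLoss_disj n)
  linarith [ApproxPrivacy.sqrt_div_logb_le hn]
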